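/- A simplicial complex $H=(V,E)$ consists of a finite vertex set $V$ and a family $E$ of subsets of $V$ (edges, of any size, the empty set included) closed under taking subsets. A complex $H$ contains a copy of a complex $F$ if there is an injection $V(F)\to V(H)$ that maps every edge of $F$ to an edge of $H$; and $\mathrm{ex}(n,F)$ denotes the maximum number of edges of a simplicial complex on $n$ vertices that contains no copy of $F$. Let $B$ be the simplicial complex on the five vertices $v_1,\dots,v_5$ whose edges are all subsets of $\{v_3,v_4\}$, $\{v_1,v_2,v_3\}$ and $\{v_1,v_4,v_5\}$. Then there is a constant $C\in\mathbb N$ such that $$\mathrm{ex}(n,B)\le \frac98\binom n2+\frac{21}{16}\,n+C\qquad\text{for every } n\ge 5 .$$ This bound is best possible up to the additive constant: there is a constant $C'\in\mathbb N$ with $\mathrm{ex}(n,B)\ge \frac98\binom n2+\frac{21}{16}n-C'$ for every $n\ge5$, and, more precisely, $\mathrm{ex}(n,B)\ge \frac98\binom n2+\frac{21}{16}n+\frac54$ whenever $n\equiv 6 \pmod 8$. -/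

import Mathlib

/-- A simplicial complex with vertex set `V` and a finite edge set closed under taking subsets.
The empty set counts as an edge, and a vertex need not be an edge by itself. (Mathlib's
`AbstractSimplicialComplex` excludes the empty face and forces every singleton to be a face.) -/
structure FinComplex (V : Type*) where
  edges : Finset (Finset V)
  down_closed : ∀ e ∈ edges, ∀ e' ⊆ e, e' ∈ edges

namespace FinComplex

/-- The simplicial complex whose edges are all subsets of members of `G`. -/
def generate {V : Type*} [DecidableEq V] (G : Finset (Finset V)) : FinComplex V where
  edges := G.biUnion Finset.powerset
  down_closed := by
    intro e he e' h
    simp only [Finset.mem_biUnion, Finset.mem_powerset] at he ⊢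
    obtain ⟨g, hg, hs⟩ := he
    exact ⟨g, hg, h.trans hs⟩

/-- `H` contains a (not necessarily induced) copy of `F`: an injection of the vertices of `F` into
those of `H` that maps edges to edges. -/
def Contains {V W : Type*} (H : FinComplex V) (F : FinComplex W) : Prop :=
  ∃ f : W ↪ V, ∀ e ∈ F.edges, e.map f ∈ H.edges

/-- The extremal number: the maximum number of edges (of all sizes) of a simplicial complex on `n`
vertices that contains no copy of `F`. -/
noncomputable def ex {W : Type*} (n : ℕ) (F : FinComplex W) : ℕ :=
  sSup {m : ℕ | ∃ H : FinComplex (Fin n), ¬ H.Contains F ∧ H.edges.card = m}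

/-- The supremum defining `ex n F` is an attained maximum as soon as `F` has an edge. -/
theorem ex_isGreatest {W : Type*} (n : ℕ) (F : FinComplex W) (hF : F.edges.Nonempty) :
    IsGreatest {m : ℕ | ∃ H : FinComplex (Fin n), ¬ H.Contains F ∧ H.edges.card = m}
      (ex n F) := by
  have hb : BddAbove {m : ℕ | ∃ H : FinComplex (Fin n), ¬ H.Contains F ∧ H.edges.card = m} := by
    refine ⟨Fintype.card (Finset (Fin n)), ?_⟩
    rintro m ⟨H, -, rfl⟩
    exact Finset.card_le_univ _
  have hne : {m : ℕ | ∃ H : FinComplex (Fin n), ¬ H.Contains F ∧ H.edges.card = m}.Nonempty := by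
    obtain ⟨e, he⟩ := hF
    refine ⟨0, ⟨∅, by simp⟩, ?_, by simp⟩
    rintro ⟨f, hf⟩
    simpa using hf e he
  exact ⟨Nat.sSup_mem hne hb, fun m hm => le_csSup hb hm⟩

/-- The complex `B` on the vertices `v₁, …, v₅ = 0, …, 4` generated by
`v₃v₄`, `v₁v₂v₃` and `v₁v₄v₅`. -/
def bowtie : FinComplex (Fin 5) :=
  generate {{2, 3}, {0, 1, 2}, {0, 3, 4}}

end FinComplex

/-! Write f(n) = (9n² + 12n)/16, which equals 9/8·C(n,2) + 21n/16.

Upper bound: induction on the vertex set. If some triangle meets at most f(n) − f(n−3) = (54n −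
45)/16 edges, delete its vertices. Otherwise the complex is `Irreducible`. The count
`card_meeting_add_le` then forces every triangle to contain a spine, that is, a pair lying in at
least three triangles; each spine even has more than 3n/8 pages. It follows that no edge has more
than three vertices, that spines are pairwise disjoint, and that pages avoid all spines. Spines with
a common page are not joined by an edge, while spines without one lose so many triangles that the
possible edges between them are paid for. With m spines and a remaining vertices this leaves at most
1 + n + C(a,2) + 2am + m + am edges, where a + 2m = n. That number is f(n) + 5/4 − (a + 2 − 6m)²/16.

Lower bound: `bookComplex` has at least this many edges. Taking m = ⌊(n+2)/8⌋ makes a + 2 − 6m the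
remainder of n + 2 modulo 8. -/

open Finset

namespace FinComplex

/-- `E` is a simplicial complex on the vertex set `S` without two triangles that meet in exactly
one vertex and are joined by an edge avoiding this vertex. -/
structure BowtieFreeOn {V : Type*} [DecidableEq V] (E : Finset (Finset V)) (S : Finset V) :
    Prop where
  subset : ∀ s ∈ E, s ⊆ S
  down : ∀ s ∈ E, ∀ t ⊆ s, t ∈ E
  no_bowtie : ∀ a b c d e : V, [a, b, c, d, e].Nodup → {a, b, c} ∈ E → {a, d, e} ∈ E → {b, d} ∉ E

variable {V : Type*} [DecidableEq V] {E : Finset (Finset V)} {S D : Finset V}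

/-- Discharging: each vertex of `R` splits a charge of at most 1 equally among the members of `F`
containing it, and each member collects at least 1. -/
theorem card_le_of_one_le_sum_inv_degree (F : Finset (Finset V)) (R : Finset V)
    (h : ∀ s ∈ F, (1 : ℚ) ≤ ∑ y ∈ R with y ∈ s, ((#{t ∈ F | y ∈ t} : ℕ) : ℚ)⁻¹) :
    #F ≤ #R := by
  have h1 : (#F : ℚ) ≤ ∑ s ∈ F, ∑ y ∈ R with y ∈ s, ((#{t ∈ F | y ∈ t} : ℕ) : ℚ)⁻¹ := by
    simpa using Finset.sum_le_sum h
  have h2 : ∑ s ∈ F, ∑ y ∈ R with y ∈ s, ((#{t ∈ F | y ∈ t} : ℕ) : ℚ)⁻¹ ≤ #R := by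
    simp only [Finset.sum_filter]
    rw [Finset.sum_comm]
    calc _ ≤ ∑ y ∈ R, (1 : ℚ) := Finset.sum_le_sum fun y _ => ?_
      _ = #R := by simp
    rw [← Finset.sum_filter, Finset.sum_const, nsmul_eq_mul]
    exact mul_inv_le_one
  exact_mod_cast h1.trans h2

theorem exists_third (hD : #D = 3) {u v : V} (hv : v ∈ D) (hu : u ∈ D) (huv : u ≠ v) :
    ∃ w, w ≠ v ∧ w ≠ u ∧ D = {v, u, w} := by
  have h1 : #((D.erase v).erase u) = 1 := by
    rw [Finset.card_erase_of_mem (by grind), Finset.card_erase_of_mem hv]; omega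
  obtain ⟨w, hw⟩ := Finset.card_eq_one.1 h1
  have hw' : w ∈ (D.erase v).erase u := by simp [hw]
  refine ⟨w, by grind, by grind, ?_⟩
  ext x
  have := Finset.ext_iff.1 hw x
  grind

/-! ### Edges meeting a fixed triangle -/

namespace BowtieFreeOn

/-- An outer vertex of an edge that leaves the triangle `D` in at least two vertices is adjacent
to only one vertex of `D`. -/
theorem not_adj_of_outer (h : BowtieFreeOn E S) (hDE : D ∈ E) (hD : #D = 3) {s : Finset V}
    (hs : s ∈ E) {u v y z : V} (hv : v ∈ D) (hvs : v ∈ s) (hy : y ∈ s) (hyD : y ∉ D) (hz : z ∈ s)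
    (hzD : z ∉ D) (hyz : y ≠ z) (hu : u ∈ D) (huv : u ≠ v) : {u, y} ∉ E := by
  obtain ⟨w, hwv, hwu, rfl⟩ := exists_third hD hv hu huv
  refine h.no_bowtie v u w y z ?_ hDE (h.down s hs _ ?_)
  · grind
  · grind

theorem card_inter_eq_one (h : BowtieFreeOn E S) (hDE : D ∈ E) (hD : #D = 3) {s : Finset V}
    (hs : s ∈ E) (hne : ¬ Disjoint s D) (h2 : 2 ≤ #(s \ D)) : #(s ∩ D) = 1 := by
  obtain ⟨v, hvs, hv⟩ := Finset.not_disjoint_iff.1 hne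
  obtain ⟨y, hy, z, hz, hyz⟩ := Finset.one_lt_card.1 h2
  refine Finset.card_eq_one.2 ⟨v, Finset.eq_singleton_iff_unique_mem.2 ⟨by grind, ?_⟩⟩
  intro u hu
  by_contra huv
  refine h.not_adj_of_outer hDE hD hs hv hvs (y := y) (z := z) ?_ ?_ ?_ ?_ hyz (u := u) ?_ huv
    (h.down s hs _ ?_) <;> grind

/-- A vertex of `D` and four outer vertices in one edge would already span a bowtie inside that
edge. -/
theorem card_sdiff_le_three (h : BowtieFreeOn E S) {s : Finset V}
    (hs : s ∈ E) (hne : ¬ Disjoint s D) : #(s \ D) ≤ 3 := by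
  obtain ⟨v, hvs, hv⟩ := Finset.not_disjoint_iff.1 hne
  by_contra! hc
  obtain ⟨t, ht, htc⟩ := Finset.exists_subset_card_eq (show 4 ≤ #(s \ D) from hc)
  obtain ⟨a, b, c, d, hab, hac, had, hbc, hbd, hcd, rfl⟩ := Finset.card_eq_four.1 htc
  have ha : a ∈ s \ D := ht (by simp)
  have hb : b ∈ s \ D := ht (by simp)
  have hc : c ∈ s \ D := ht (by simp)
  have hd : d ∈ s \ D := ht (by simp)
  refine h.no_bowtie v a b c d ?_ (h.down s hs _ ?_) (h.down s hs _ ?_) (h.down s hs _ ?_)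
  · have hva : v ≠ a := by grind
    have hvb : v ≠ b := by grind
    have hvc : v ≠ c := by grind
    have hvd : v ≠ d := by grind
    simp [*]
  all_goals grind

end BowtieFreeOn

/-- The vertices outside `D` that lie in an edge meeting `D` and having at least two vertices
outside `D`. -/
def outer (E : Finset (Finset V)) (S D : Finset V) : Finset V :=
  {y ∈ S | y ∉ D ∧ ∃ s ∈ E, y ∈ s ∧ ¬ Disjoint s D ∧ 2 ≤ #(s \ D)}

/-- The edges meeting `D` in `i` and its complement in `j` vertices. -/
def crossing (E : Finset (Finset V)) (D : Finset V) (i j : ℕ) : Finset (Finset V) :=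
  {s ∈ E | #(s ∩ D) = i ∧ #(s \ D) = j}

theorem eq_insert_of_mem_crossing_one_two {s : Finset V} (hs : s ∈ crossing E D 1 2) :
    s ∈ E ∧ ∃ v y z, v ∈ D ∧ y ∉ D ∧ z ∉ D ∧ y ≠ z ∧ s = {v, y, z} := by
  simp only [crossing, Finset.mem_filter] at hs
  obtain ⟨hs, h1, h2⟩ := hs
  obtain ⟨v, hv⟩ := Finset.card_eq_one.1 h1
  obtain ⟨y, z, hyz, hy⟩ := Finset.card_eq_two.1 h2
  have hs' : s = {v, y, z} := by
    ext x
    have h3 := Finset.ext_iff.1 hv x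
    have h4 := Finset.ext_iff.1 hy x
    grind
  have h3 := Finset.ext_iff.1 hv v
  have h4 := Finset.ext_iff.1 hy y
  have h5 := Finset.ext_iff.1 hy z
  exact ⟨hs, v, y, z, by grind, by grind, by grind, hyz, hs'⟩

namespace BowtieFreeOn

theorem mem_crossing_one_two_of_mem (h : BowtieFreeOn E S) (hDE : D ∈ E) (hD : #D = 3)
    {v y z : V} (hv : v ∈ D) (hy : y ∉ D) (hz : z ∉ D) (hyz : y ≠ z) (hs : {v, y, z} ∈ E)
    {t : Finset V} (ht : t ∈ crossing E D 1 2) (hyt : y ∈ t) :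
    ∃ u, u ∉ D ∧ u ≠ y ∧ t = {v, y, u} := by
  obtain ⟨htE, v', y', z', hv', hy', hz', hyz', rfl⟩ := eq_insert_of_mem_crossing_one_two ht
  have hvv : v' = v := by
    by_contra hne
    refine h.not_adj_of_outer hDE hD hs hv (y := y) (z := z) (by simp) (by simp) hy (by simp) hz hyz
      hv' hne (h.down _ htE _ ?_)
    grind
  subst hvv
  rcases (show y = y' ∨ y = z' by grind) with rfl | rfl
  · exact ⟨z', hz', hyz'.symm, rfl⟩
  · exact ⟨y', hy', hyz', by grind⟩

/-- If `vzu` is a second triangle at `z`, then a triangle `vyu'` with `u'` different from `z` and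
`u` forms a bowtie with it through the edge `yz`. Hence at most `vyz` and `vyu` contain `y`. -/
theorem degree_le_of_two (h : BowtieFreeOn E S) (hDE : D ∈ E) (hD : #D = 3)
    {v y z : V} (hv : v ∈ D) (hy : y ∉ D) (hz : z ∉ D) (hyz : y ≠ z) (hs : {v, y, z} ∈ E)
    (hdeg : 1 < #{t ∈ crossing E D 1 2 | z ∈ t}) : #{t ∈ crossing E D 1 2 | y ∈ t} ≤ 2 := by
  obtain ⟨t, ht, hne⟩ := Finset.exists_mem_ne hdeg {v, y, z}
  rw [Finset.mem_filter] at ht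
  have hs' : {v, z, y} ∈ E := by rwa [Finset.pair_comm z y]
  obtain ⟨u, hu, huz, rfl⟩ := h.mem_crossing_one_two_of_mem hDE hD hv hz hy hyz.symm hs' ht.1 ht.2
  have huy : u ≠ y := by
    rintro rfl
    exact hne (by grind)
  have htE : {v, z, u} ∈ E := (eq_insert_of_mem_crossing_one_two ht.1).1
  have hsub : {t ∈ crossing E D 1 2 | y ∈ t} ⊆ {{v, y, z}, {v, y, u}} := by
    intro t' ht'
    rw [Finset.mem_filter] at ht'
    obtain ⟨u', hu', huy', rfl⟩ := h.mem_crossing_one_two_of_mem hDE hD hv hy hz hyz hs ht'.1 ht'.2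
    have htE' : {v, y, u'} ∈ E := (eq_insert_of_mem_crossing_one_two ht'.1).1
    by_cases huz' : u' = z
    · simp [huz']
    by_cases huu : u' = u
    · simp [huu]
    exfalso
    refine h.no_bowtie v y u' z u ?_ htE' htE (h.down _ hs _ (by grind))
    grind
  exact (Finset.card_le_card hsub).trans Finset.card_le_two

/-- The two outer vertices of such a triangle have degrees p, q with p = 1, or q = 1, or p = q = 2,
so 1/p + 1/q ≥ 1 and discharging applies. -/
theorem card_crossing_one_two_le (h : BowtieFreeOn E S) (hDE : D ∈ E) (hD : #D = 3) :
    #(crossing E D 1 2) ≤ #(outer E S D) := by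
  refine card_le_of_one_le_sum_inv_degree _ _ fun s hs => ?_
  obtain ⟨hsE, v, y, z, hv, hy, hz, hyz, rfl⟩ := eq_insert_of_mem_crossing_one_two hs
  have hsub := h.subset _ hsE
  have hne : ¬ Disjoint ({v, y, z} : Finset V) D := Finset.not_disjoint_iff.2 ⟨v, by simp, hv⟩
  have hc : 2 ≤ #(({v, y, z} : Finset V) \ D) := by
    rw [crossing, Finset.mem_filter] at hs
    exact hs.2.2.ge
  have hyo : y ∈ outer E S D :=
    Finset.mem_filter.2 ⟨hsub (by simp), hy, _, hsE, by simp, hne, hc⟩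
  have hzo : z ∈ outer E S D :=
    Finset.mem_filter.2 ⟨hsub (by simp), hz, _, hsE, by simp, hne, hc⟩
  have hle : ∑ x ∈ {y, z}, ((#{t ∈ crossing E D 1 2 | x ∈ t} : ℕ) : ℚ)⁻¹ ≤
      ∑ x ∈ outer E S D with x ∈ ({v, y, z} : Finset V),
        ((#{t ∈ crossing E D 1 2 | x ∈ t} : ℕ) : ℚ)⁻¹ := by
    refine Finset.sum_le_sum_of_subset_of_nonneg ?_ fun _ _ _ => by positivity
    intro x hx
    rw [Finset.mem_filter]
    rcases (show x = y ∨ x = z by simpa using hx) with rfl | rfl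
    · exact ⟨hyo, by simp⟩
    · exact ⟨hzo, by simp⟩
  refine le_trans ?_ hle
  rw [Finset.sum_pair hyz]
  have hy1 : 0 < #{t ∈ crossing E D 1 2 | y ∈ t} :=
    Finset.card_pos.2 ⟨_, Finset.mem_filter.2 ⟨hs, by simp⟩⟩
  have hz1 : 0 < #{t ∈ crossing E D 1 2 | z ∈ t} :=
    Finset.card_pos.2 ⟨_, Finset.mem_filter.2 ⟨hs, by simp⟩⟩
  have hs' : {v, z, y} ∈ E := by rwa [Finset.pair_comm z y]
  have key1 := h.degree_le_of_two hDE hD hv hy hz hyz hsE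
  have key2 := h.degree_le_of_two hDE hD hv hz hy hyz.symm hs'
  generalize #{t ∈ crossing E D 1 2 | y ∈ t} = p at *
  generalize #{t ∈ crossing E D 1 2 | z ∈ t} = q at *
  have hp : (0 : ℚ) ≤ (p : ℚ)⁻¹ := by positivity
  have hq : (0 : ℚ) ≤ (q : ℚ)⁻¹ := by positivity
  rcases (show p = 1 ∨ q = 1 ∨ (p = 2 ∧ q = 2) by omega) with rfl | rfl | ⟨rfl, rfl⟩
  · norm_num
  · norm_num
  · norm_num

/-- An outer vertex lies in only one edge of this type: a second one would have the same vertex in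
`D`, and any new outer vertex of it would complete a bowtie. -/
theorem card_crossing_one_three_le (h : BowtieFreeOn E S) (hDE : D ∈ E) (hD : #D = 3) :
    #(crossing E D 1 3) ≤ #(outer E S D) := by
  refine card_le_of_one_le_sum_inv_degree _ _ fun s hs => ?_
  have hs' := hs
  rw [crossing, Finset.mem_filter] at hs'
  obtain ⟨hsE, hi, ho⟩ := hs'
  obtain ⟨v, hv⟩ := Finset.card_pos.1 (show 0 < #(s ∩ D) by omega)
  obtain ⟨y, z, u, hyz, hyu, hzu, hyzu⟩ := Finset.card_eq_three.1 ho
  have hy : y ∈ s \ D := by simp [hyzu]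
  have hz : z ∈ s \ D := by simp [hyzu]
  have hu : u ∈ s \ D := by simp [hyzu]
  rw [Finset.mem_sdiff] at hy hz hu
  rw [Finset.mem_inter] at hv
  have hyo : y ∈ outer E S D :=
    Finset.mem_filter.2 ⟨h.subset _ hsE hy.1, hy.2, _, hsE, hy.1,
      Finset.not_disjoint_iff.2 ⟨v, hv⟩, by omega⟩
  have hdeg : {t ∈ crossing E D 1 3 | y ∈ t} = {s} := by
    refine Finset.eq_singleton_iff_unique_mem.2 ⟨Finset.mem_filter.2 ⟨hs, hy.1⟩, fun t ht => ?_⟩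
    simp only [crossing, Finset.mem_filter] at ht
    obtain ⟨⟨htE, hti, hto⟩, hyt⟩ := ht
    have htD : ∀ v' ∈ t ∩ D, v' = v := by
      intro v' hv'
      rw [Finset.mem_inter] at hv'
      by_contra hne
      exact h.not_adj_of_outer hDE hD hsE hv.2 hv.1 hy.1 hy.2 hz.1 hz.2 hyz hv'.2 hne
        (h.down _ htE _ (by grind))
    obtain ⟨v', hv'⟩ := Finset.card_pos.1 (show 0 < #(t ∩ D) by omega)
    obtain rfl := htD v' hv'
    have hsub : t \ D ⊆ s \ D := by
      intro x hx
      by_contra hxs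
      refine h.no_bowtie v' y x z u ?_ (h.down _ htE _ ?_) (h.down _ hsE _ ?_) (h.down _ hsE _ ?_)
      all_goals grind
    have heq := Finset.eq_of_subset_of_card_le hsub (by omega)
    have hsD : ∀ w ∈ s ∩ D, w = v' := by
      intro w hw
      exact Finset.card_le_one.1 hi.le _ hw _ (by simpa using hv)
    ext x
    have h1 := Finset.ext_iff.1 heq x
    have h2 := htD x
    have h3 := hsD x
    grind
  calc (1 : ℚ) = ((#{t ∈ crossing E D 1 3 | y ∈ t} : ℕ) : ℚ)⁻¹ := by simp [hdeg]
    _ ≤ _ := Finset.single_le_sum (f := fun y => ((#{t ∈ crossing E D 1 3 | y ∈ t} : ℕ) : ℚ)⁻¹)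
      (fun _ _ => by positivity) (Finset.mem_filter.2 ⟨hyo, hy.1⟩)

/-- A vertex of `outer` has at most one neighbour in `D`, any other vertex at most three. The saving
of 2 per outer vertex later pays for the larger edges. -/
theorem card_crossing_one_one_add_le (h : BowtieFreeOn E S) (hDE : D ∈ E) (hD : #D = 3) :
    #(crossing E D 1 1) + 2 * #(outer E S D) ≤ 3 * #(S \ D) := by
  have h1 : #(crossing E D 1 1) ≤ ∑ y ∈ S \ D, #{v ∈ D | {v, y} ∈ E} := by
    rw [← Finset.card_sigma]
    refine Finset.card_le_card_of_surjOn (fun x => {x.2, x.1}) ?_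
    intro s hs
    simp only [crossing, Finset.coe_filter, Set.mem_ofPred_eq] at hs
    obtain ⟨hsE, hi, ho⟩ := hs
    obtain ⟨v, hv⟩ := Finset.card_eq_one.1 hi
    obtain ⟨y, hy⟩ := Finset.card_eq_one.1 ho
    have hvm : v ∈ s ∩ D := by simp [hv]
    have hym : y ∈ s \ D := by simp [hy]
    have hsv : {v, y} = s := by
      ext x
      have h3 := Finset.ext_iff.1 hv x
      have h4 := Finset.ext_iff.1 hy x
      grind
    refine ⟨⟨y, v⟩, ?_, hsv⟩
    have := h.subset s hsE
    simp only [Finset.coe_sigma, Set.mem_sigma_iff, Finset.mem_coe, Finset.mem_filter]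
    exact ⟨by grind, by grind, hsv ▸ hsE⟩
  have h2 : 2 * #(outer E S D) = ∑ y ∈ S \ D, if y ∈ outer E S D then 2 else 0 := by
    rw [← Finset.sum_filter, Finset.sum_const, smul_eq_mul, mul_comm]
    congr 2
    ext y
    simp only [outer, Finset.mem_filter, Finset.mem_sdiff]
    grind
  have h3 : 3 * #(S \ D) = ∑ y ∈ S \ D, 3 := by simp [mul_comm]
  rw [h2, h3]
  refine (Nat.add_le_add_right h1 _).trans ?_
  rw [← Finset.sum_add_distrib]
  refine Finset.sum_le_sum fun y hy => ?_
  split_ifs with hyo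
  · suffices #{v ∈ D | {v, y} ∈ E} ≤ 1 by omega
    simp only [outer, Finset.mem_filter] at hyo
    obtain ⟨hyS, hyD, s, hsE, hys, hne, hc⟩ := hyo
    obtain ⟨v, hvs, hv⟩ := Finset.not_disjoint_iff.1 hne
    obtain ⟨z, hz, hzy⟩ := Finset.exists_mem_ne (show 1 < #(s \ D) by omega) y
    rw [Finset.mem_sdiff] at hz
    have : Nonempty V := ⟨v⟩
    refine Finset.card_le_one_iff_subset_singleton.2 ⟨v, fun u hu => ?_⟩
    rw [Finset.mem_filter] at hu
    by_contra hne
    exact h.not_adj_of_outer hDE hD hsE hv hvs hys hyD hz.1 hz.2 hzy.symm hu.1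
      (by simpa using hne) hu.2
  · have := Finset.card_filter_le D (fun v => {v, y} ∈ E)
    omega

/-- The number of edges that meet a triangle `D`. -/
theorem card_meeting_add_le (h : BowtieFreeOn E S) (hDE : D ∈ E) (hD : #D = 3) :
    #{s ∈ E | ¬ Disjoint s D} + #(outer E S D) + 2 ≤
      3 * #S + (#(crossing E D 2 1) + #(crossing E D 3 1)) + #(crossing E D 1 3) := by
  have hsub : {s ∈ E | ¬ Disjoint s D} ⊆ (D.powerset.erase ∅) ∪ (crossing E D 1 1 ∪
      (crossing E D 2 1 ∪ (crossing E D 3 1 ∪ (crossing E D 1 2 ∪ crossing E D 1 3)))) := by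
    intro s hs
    rw [Finset.mem_filter] at hs
    have h0 : 0 < #(s ∩ D) := by
      rw [Finset.card_pos, ← Finset.not_disjoint_iff_nonempty_inter]
      exact hs.2
    have h1 : #(s ∩ D) ≤ 3 := hD ▸ Finset.card_le_card Finset.inter_subset_right
    have h2 := h.card_sdiff_le_three hs.1 hs.2
    have h3 := h.card_inter_eq_one hDE hD hs.1 hs.2
    simp only [Finset.mem_union, crossing, Finset.mem_filter, hs.1, true_and]
    by_cases h4 : #(s \ D) = 0
    · left
      rw [Finset.card_eq_zero, Finset.sdiff_eq_empty_iff_subset] at h4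
      refine Finset.mem_erase.2 ⟨?_, Finset.mem_powerset.2 h4⟩
      rintro rfl
      simp at h0
    · right
      omega
  have h0 : #(D.powerset.erase ∅) = 7 := by
    rw [Finset.card_erase_of_mem (by simp), Finset.card_powerset, hD]; norm_num
  have h1 := h.card_crossing_one_one_add_le hDE hD
  have h2 := h.card_crossing_one_two_le hDE hD
  have h3 : #(S \ D) + 3 = #S := by
    rw [← hD, Finset.card_sdiff_add_card_eq_card (h.subset D hDE)]
  have h4 := Finset.card_le_card hsub
  have h5 := h4.trans ((Finset.card_union_le _ _).trans (Nat.add_le_add_left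
    ((Finset.card_union_le _ _).trans (Nat.add_le_add_left
    ((Finset.card_union_le _ _).trans (Nat.add_le_add_left
    ((Finset.card_union_le _ _).trans (Nat.add_le_add_left
    (Finset.card_union_le _ _) _)) _)) _)) _))
  -- With o outer vertices: 7 nonempty subsets of `D`, at most 3(n − 3) − 2o pairs and at most o
  -- triangles of type (1,2), in total 3n − 2 − o.
  omega

end BowtieFreeOn

/-! ### Pages and spines -/

/-- The vertices that extend `p` to a larger edge. -/
def pages (E : Finset (Finset V)) (S p : Finset V) : Finset V :=
  {y ∈ S | y ∉ p ∧ insert y p ∈ E}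

/-- The pairs that lie in at least three triangles. -/
def spines (E : Finset (Finset V)) (S : Finset V) : Finset (Finset V) :=
  {p ∈ E | #p = 2 ∧ 3 ≤ #(pages E S p)}

theorem exists_eq_pair {p : Finset V} (hp : #p = 2) {v : V} (hv : v ∈ p) :
    ∃ w, w ≠ v ∧ p = {v, w} := by
  obtain ⟨a, b, hab, rfl⟩ := Finset.card_eq_two.1 hp
  rcases (show v = a ∨ v = b by simpa using hv) with rfl | rfl
  · exact ⟨b, hab.symm, rfl⟩
  · exact ⟨a, hab, Finset.pair_comm _ _⟩

theorem exists_eq_triple {p : Finset V} (hD : #D = 3) (hpD : p ⊆ D) (hp : #p = 2) :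
    ∃ v w x, v ≠ w ∧ x ≠ v ∧ x ≠ w ∧ p = {v, w} ∧ D = {v, w, x} := by
  obtain ⟨v, w, hvw, rfl⟩ := Finset.card_eq_two.1 hp
  obtain ⟨x, hxv, hxw, h⟩ := exists_third hD (hpD (by simp)) (hpD (show w ∈ _ by simp)) hvw.symm
  exact ⟨v, w, x, hvw, hxv, hxw, rfl, h⟩

namespace BowtieFreeOn

theorem mem_pages_of_subset (h : BowtieFreeOn E S) {p s : Finset V} (hs : s ∈ E) (hp : p ⊆ s)
    {y : V} (hy : y ∈ s) (hyp : y ∉ p) : y ∈ pages E S p :=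
  Finset.mem_filter.2 ⟨h.subset s hs hy, hyp, h.down s hs _ (Finset.insert_subset hy hp)⟩

/-- If `vw` is a spine then `vx` lies in no triangle other than `vwx`. -/
theorem eq_of_spine (h : BowtieFreeOn E S) {v w x y : V} (hvw : v ≠ w) (hxv : x ≠ v) (hxw : x ≠ w)
    (hE : {v, w, x} ∈ E) (hsp : 3 ≤ #(pages E S {v, w})) (hyv : y ≠ v) (hyx : y ≠ x)
    (hy : {v, x, y} ∈ E) : y = w := by
  by_contra hyw
  -- Three pages leave one avoiding `x` and `y`; then `vwu` and `vxy` are joined by `wx`.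
  obtain ⟨u, hu, hux⟩ : ∃ u ∈ pages E S {v, w}, u ∉ ({x, y} : Finset V) := by
    by_contra! hc
    have := (Finset.card_le_card hc).trans Finset.card_le_two
    omega
  simp only [pages, Finset.mem_filter] at hu
  obtain ⟨-, hu, huE⟩ := hu
  refine h.no_bowtie v w u x y ?_ (h.down _ huE _ (by grind)) hy (h.down _ hE _ (by grind))
  simp only [Finset.mem_insert, Finset.mem_singleton, not_or] at hux hu
  obtain ⟨hux, huy⟩ := hux
  obtain ⟨huv, huw⟩ := hu
  simp [*, Ne.symm]

/-- The third vertex of `D` is one of the at most two pages of `p`, so at most one page lies outside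
`D`. -/
theorem outside_unique (h : BowtieFreeOn E S) (hDE : D ∈ E) (hD : #D = 3) {p s t : Finset V}
    (hp : #p = 2) (hpD : p ⊆ D) (hpages : #(pages E S p) ≤ 2) (hs : s ∈ E) (ht : t ∈ E)
    (hps : p ⊆ s) (hpt : p ⊆ t) {y z : V} (hy : y ∈ s \ D) (hz : z ∈ t \ D) : y = z := by
  by_contra hyz
  obtain ⟨v, w, x, hvw, hxv, hxw, rfl, rfl⟩ := exists_eq_triple hD hpD hp
  rw [Finset.mem_sdiff] at hy hz
  have hsub : {x, y, z} ⊆ pages E S {v, w} := by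
    have h1 := h.mem_pages_of_subset hDE hpD (y := x) (by simp) (by simp [hxv, hxw])
    have h2 := h.mem_pages_of_subset hs hps hy.1 (fun hh => hy.2 (hpD hh))
    have h3 := h.mem_pages_of_subset ht hpt hz.1 (fun hh => hz.2 (hpD hh))
    grind
  have h3 : #{x, y, z} = 3 := Finset.card_eq_three.2 ⟨x, y, z, by grind, by grind, hyz, rfl⟩
  have := Finset.card_le_card hsub
  omega

theorem card_crossing_of_no_spine (h : BowtieFreeOn E S) (hDE : D ∈ E) (hD : #D = 3)
    (hno : ∀ p ⊆ D, #p = 2 → #(pages E S p) ≤ 2) :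
    #(crossing E D 2 1) + #(crossing E D 3 1) ≤ 4 := by
  have h21 : #(crossing E D 2 1) ≤ 3 := by
    have hcard : #(D.powersetCard 2) = 3 := by
      rw [Finset.card_powersetCard, hD]; rfl
    rw [← hcard]
    refine Finset.card_le_card_of_injOn (fun s => s ∩ D) ?_ ?_
    · intro s hs
      simp only [crossing, Finset.coe_filter, Set.mem_ofPred_eq] at hs
      simp [Finset.mem_powersetCard, hs.2.1]
    · intro s hs t ht hst
      simp only [crossing, Finset.coe_filter, Set.mem_ofPred_eq] at hs ht hst
      obtain ⟨y, hy⟩ := Finset.card_eq_one.1 hs.2.2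
      obtain ⟨z, hz⟩ := Finset.card_eq_one.1 ht.2.2
      have hyz : y = z := h.outside_unique hDE hD hs.2.1 Finset.inter_subset_right
        (hno _ Finset.inter_subset_right hs.2.1) hs.1 ht.1 Finset.inter_subset_left
        (hst ▸ Finset.inter_subset_left) (by simp [hy]) (by simp [hz])
      rw [← Finset.sdiff_union_inter s D, ← Finset.sdiff_union_inter t D, hy, hz, hyz, hst]
  have h31 : #(crossing E D 3 1) ≤ 1 := by
    refine Finset.card_le_one.2 fun s hs t ht => ?_
    simp only [crossing, Finset.mem_filter] at hs ht
    have hsD : s ∩ D = D := Finset.eq_of_subset_of_card_le Finset.inter_subset_right (by omega)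
    have htD : t ∩ D = D := Finset.eq_of_subset_of_card_le Finset.inter_subset_right (by omega)
    obtain ⟨y, hy⟩ := Finset.card_eq_one.1 hs.2.2
    obtain ⟨z, hz⟩ := Finset.card_eq_one.1 ht.2.2
    obtain ⟨p, hpD, hp⟩ := Finset.exists_subset_card_eq (show 2 ≤ #D by omega)
    have hyz : y = z := h.outside_unique hDE hD hp hpD (hno p hpD hp) hs.1 ht.1
      (hpD.trans (Finset.inter_eq_right.1 hsD)) (hpD.trans (Finset.inter_eq_right.1 htD))
      (by simp [hy]) (by simp [hz])
    rw [← Finset.sdiff_union_inter s D, ← Finset.sdiff_union_inter t D, hy, hz, hyz, hsD, htD]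
  omega

/-- By `eq_of_spine`, an edge that leaves `D` and contains two of its vertices meets it exactly in
the spine. Such edges correspond to pages other than the third vertex of `D`. -/
theorem card_crossing_of_spine (h : BowtieFreeOn E S) (hDE : D ∈ E) (hD : #D = 3) {p : Finset V}
    (hpD : p ⊆ D) (hp : #p = 2) (hsp : 3 ≤ #(pages E S p)) :
    #(crossing E D 2 1) + #(crossing E D 3 1) + 1 ≤ #(pages E S p) := by
  obtain ⟨v, w, x, hvw, hxv, hxw, rfl, rfl⟩ := exists_eq_triple hD hpD hp
  have hE' : {w, v, x} ∈ E := by rwa [Finset.insert_comm]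
  have hsp' : 3 ≤ #(pages E S {w, v}) := by rwa [Finset.pair_comm]
  have hx : ∀ s ∈ E, ∀ y ∈ s, y ∉ ({v, w, x} : Finset V) → x ∈ s → v ∉ s ∧ w ∉ s := by
    intro s hs y hy hyD hxs
    constructor
    · intro hv
      have := h.eq_of_spine hvw hxv hxw hDE hsp (y := y) (by grind) (by grind)
        (h.down s hs _ (by grind))
      grind
    · intro hw
      have := h.eq_of_spine hvw.symm hxw hxv hE' hsp' (y := y) (by grind) (by grind)
        (h.down s hs _ (by grind))
      grind
  have h31 : crossing E {v, w, x} 3 1 = ∅ := by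
    refine Finset.eq_empty_of_forall_notMem fun s hs => ?_
    simp only [crossing, Finset.mem_filter] at hs
    have hsD := Finset.inter_eq_right.1
      (Finset.eq_of_subset_of_card_le (s := s ∩ {v, w, x}) Finset.inter_subset_right (by omega))
    obtain ⟨y, hy⟩ := Finset.card_pos.1 (show 0 < #(s \ {v, w, x}) by omega)
    rw [Finset.mem_sdiff] at hy
    exact (hx s hs.1 y hy.1 hy.2 (hsD (by simp))).1 (hsD (by simp))
  have h21 : crossing E {v, w, x} 2 1 ⊆
      ((pages E S {v, w}).erase x).image (fun y => insert y {v, w}) := by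
    intro s hs
    simp only [crossing, Finset.mem_filter] at hs
    obtain ⟨hsE, h2, h1⟩ := hs
    obtain ⟨y, hy⟩ := Finset.card_eq_one.1 h1
    have hym : y ∈ s \ {v, w, x} := by simp [hy]
    rw [Finset.mem_sdiff] at hym
    have hxs : x ∉ s := by
      intro hxs
      have := hx s hsE y hym.1 hym.2 hxs
      have hsub : s ∩ {v, w, x} ⊆ {x} := by grind
      have := Finset.card_le_card hsub
      simp at this
      omega
    have heq : s ∩ {v, w, x} = {v, w} :=
      Finset.eq_of_subset_of_card_le (by grind) (by omega)
    have hs : s = insert y {v, w} := by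
      rw [← Finset.sdiff_union_inter s {v, w, x}, hy, heq]; rfl
    refine Finset.mem_image.2 ⟨y, Finset.mem_erase.2 ⟨by grind, ?_⟩, hs.symm⟩
    exact h.mem_pages_of_subset hsE (by grind) hym.1 (by grind)
  have hxp : x ∈ pages E S {v, w} :=
    h.mem_pages_of_subset hDE hpD (by simp) (by simp [hxv, hxw])
  have h1 := (Finset.card_le_card h21).trans Finset.card_image_le
  rw [Finset.card_erase_of_mem hxp] at h1
  rw [h31, Finset.card_empty]
  omega

/-! ### Structure of irreducible complexes -/

/-- Every triangle meets so many edges that deleting its vertices is too costly. -/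
structure Irreducible (E : Finset (Finset V)) (S : Finset V) : Prop extends BowtieFreeOn E S where
  large : 13 ≤ #S
  meeting : ∀ D ∈ E, #D = 3 → 54 * #S < 16 * #{s ∈ E | ¬ Disjoint s D} + 45

end BowtieFreeOn

open BowtieFreeOn

namespace BowtieFreeOn.Irreducible

theorem exists_spine (h : Irreducible E S) (hDE : D ∈ E) (hD : #D = 3) :
    ∃ p ⊆ D, p ∈ spines E S := by
  by_contra! hc
  have h1 := h.card_meeting_add_le hDE hD
  have h2 := h.card_crossing_of_no_spine hDE hD fun p hpD hp => by
    by_contra! hsp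
    exact hc p hpD (Finset.mem_filter.2 ⟨h.down D hDE p hpD, hp, hsp⟩)
  have h3 := h.card_crossing_one_three_le hDE hD
  have h4 := h.meeting D hDE hD
  -- Without a spine `D` meets at most 3n + 2 edges, so 54n < 16(3n + 2) + 45, that is, 6n < 77.
  -- This is where 13 comes from.
  have := h.large
  omega

theorem card_le_three (h : Irreducible E S) {s : Finset V} (hs : s ∈ E) : #s ≤ 3 := by
  by_contra! hc
  obtain ⟨D, hDs, hD⟩ := Finset.exists_subset_card_eq (show 3 ≤ #s by omega)
  have hDE := h.down s hs D hDs
  obtain ⟨p, hpD, hp⟩ := h.exists_spine hDE hD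
  simp only [spines, Finset.mem_filter] at hp
  obtain ⟨u, hu, huD⟩ := Finset.exists_mem_notMem_of_card_lt_card (show #D < #s by omega)
  obtain ⟨v, w, x, hvw, hxv, hxw, rfl, rfl⟩ := exists_eq_triple hD hpD hp.2.1
  have := h.eq_of_spine hvw hxv hxw hDE hp.2.2 (y := u) (by grind) (by grind)
    (h.down s hs _ (by grind))
  grind

/-- Type (1,3) is now empty, so only the pages of the spine can lift the count above 3n, and every
outer vertex must be compensated by one more page. -/
theorem lt_card_pages (h : Irreducible E S) (hDE : D ∈ E) (hD : #D = 3) {p : Finset V}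
    (hpD : p ⊆ D) (hp : p ∈ spines E S) :
    6 * #S + 3 + 16 * #(outer E S D) < 16 * #(pages E S p) := by
  simp only [spines, Finset.mem_filter] at hp
  have h1 := h.card_meeting_add_le hDE hD
  have h2 := h.card_crossing_of_spine hDE hD hpD hp.2.1 hp.2.2
  have h3 : crossing E D 1 3 = ∅ := by
    refine Finset.eq_empty_of_forall_notMem fun s hs => ?_
    simp only [crossing, Finset.mem_filter] at hs
    have := h.card_le_three hs.1
    have := Finset.card_sdiff_add_card_inter s D
    omega
  have h4 := h.meeting D hDE hD
  rw [h3, Finset.card_empty] at h1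
  omega

theorem card_insert_page {p : Finset V} (hp : p ∈ spines E S) {x : V} (hx : x ∈ pages E S p) :
    #(insert x p) = 3 ∧ insert x p ∈ E := by
  have hx' := (Finset.mem_filter.1 hx).2
  rw [Finset.card_insert_of_notMem hx'.1, (Finset.mem_filter.1 hp).2.1]
  exact ⟨rfl, hx'.2⟩

theorem pages_nonempty {p : Finset V} (hp : p ∈ spines E S) : (pages E S p).Nonempty := by
  simp only [spines, Finset.mem_filter] at hp
  exact Finset.card_pos.1 (by omega)

theorem lt_card_pages_of_mem_spines (h : Irreducible E S) {p : Finset V} (hp : p ∈ spines E S) :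
    6 * #S + 3 < 16 * #(pages E S p) := by
  obtain ⟨x, hx⟩ := pages_nonempty hp
  obtain ⟨h1, h2⟩ := card_insert_page hp hx
  have := h.lt_card_pages h2 h1 (Finset.subset_insert x p) hp
  omega

theorem two_le_card_sdiff {s : Finset V} {y z : V} (hy : y ∈ s) (hyD : y ∉ D)
    (hz : z ∈ s) (hzD : z ∉ D) (hyz : y ≠ z) : 2 ≤ #(s \ D) :=
  Finset.one_lt_card.2 ⟨y, by simp [*], z, by simp [*], hyz⟩

/-- All pages of `vu` are outer vertices of a triangle on `vw`, so `lt_card_pages` gives a strict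
inequality. By symmetry, two spines cannot share a vertex. -/
theorem card_pages_lt_of_inter (h : Irreducible E S) {v w u : V} (hwv : w ≠ v) (huv : u ≠ v)
    (hwu : w ≠ u) (hp : {v, w} ∈ spines E S) (hq : {v, u} ∈ spines E S) :
    #(pages E S {v, u}) < #(pages E S {v, w}) := by
  obtain ⟨x, hx⟩ := pages_nonempty hp
  obtain ⟨h1, h2⟩ := card_insert_page hp hx
  have key := h.lt_card_pages h2 h1 (Finset.subset_insert x _) hp
  simp only [spines, Finset.mem_filter] at hp hq
  simp only [pages, Finset.mem_filter] at hx
  have hvwx : {v, w, x} ∈ E := by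
    have : ({v, w, x} : Finset V) = insert x {v, w} := by grind
    rwa [this]
  have hxv : x ≠ v := by grind
  have hxw : x ≠ w := by grind
  have hvwu : {v, w, u} ∉ E := by
    intro hE
    obtain ⟨y, hy, hyw⟩ := Finset.exists_mem_ne (show 1 < #(pages E S {v, u}) by omega) w
    simp only [pages, Finset.mem_filter] at hy
    exact hyw (h.eq_of_spine hwv.symm huv hwu.symm hE hp.2.2 (by grind) (by grind)
      (h.down _ hy.2.2 _ (by grind)))
  have hux : u ≠ x := by
    rintro rfl
    exact hvwu hvwx
  have hsub : pages E S {v, u} ⊆ outer E S (insert x {v, w}) := by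
    intro y hy
    simp only [pages, Finset.mem_filter] at hy
    obtain ⟨hyS, hyq, hyE⟩ := hy
    have hyw : y ≠ w := by
      rintro rfl
      exact hvwu (h.down _ hyE _ (by grind))
    have hyx : y ≠ x := by
      rintro rfl
      exact hwu.symm (h.eq_of_spine hwv.symm hxv hxw hvwx hp.2.2 huv hux
        (h.down _ hyE _ (by grind)))
    have hyD : y ∉ insert x ({v, w} : Finset V) := by grind
    have huD : u ∉ insert x ({v, w} : Finset V) := by grind
    exact Finset.mem_filter.2 ⟨hyS, hyD, _, hyE, by simp,
      Finset.not_disjoint_iff.2 ⟨v, by simp, by simp⟩,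
      two_le_card_sdiff (y := y) (z := u) (by simp) hyD (by simp) huD (by grind)⟩
  have := Finset.card_le_card hsub
  omega

theorem disjoint_spines (h : Irreducible E S) {p q : Finset V} (hp : p ∈ spines E S)
    (hq : q ∈ spines E S) (hpq : p ≠ q) : Disjoint p q := by
  rw [Finset.disjoint_left]
  intro v hvp hvq
  obtain ⟨w, hwv, rfl⟩ := exists_eq_pair (Finset.mem_filter.1 hp).2.1 hvp
  obtain ⟨u, huv, rfl⟩ := exists_eq_pair (Finset.mem_filter.1 hq).2.1 hvq
  have hwu : w ≠ u := by
    rintro rfl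
    exact hpq rfl
  have h1 := h.card_pages_lt_of_inter hwv huv hwu hp hq
  have h2 := h.card_pages_lt_of_inter huv hwv hwu.symm hq hp
  omega

/-- If a page `v` of `p` lay in `q`, the pages of `q` would be outer for the triangle `insert v p`.
Then `p` has more than 3n/4 pages and `q` more than 3n/8, but the two page sets are disjoint. -/
theorem disjoint_pages_spine (h : Irreducible E S) {p q : Finset V} (hp : p ∈ spines E S)
    (hq : q ∈ spines E S) : Disjoint (pages E S p) q := by
  rw [Finset.disjoint_left]
  intro v hvp hvq
  obtain ⟨h1, h2⟩ := card_insert_page hp hvp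
  have key := h.lt_card_pages h2 h1 (Finset.subset_insert v p) hp
  have key' := h.lt_card_pages_of_mem_spines hq
  have hvp' : v ∉ p := (Finset.mem_filter.1 hvp).2.1
  have hpq : p ≠ q := by
    rintro rfl
    exact hvp' hvq
  have hdis := h.disjoint_spines hp hq hpq
  obtain ⟨w, hwv, rfl⟩ := exists_eq_pair (Finset.mem_filter.1 hq).2.1 hvq
  have hwp : w ∉ p := fun hw => Finset.disjoint_left.1 hdis hw (by simp)
  have hwD : w ∉ insert v p := by grind
  have hsp := (Finset.mem_filter.1 hq).2.2
  have hpages : ∀ x ∈ pages E S {v, w}, x ∉ insert v p ∧ {v, w, x} ∈ E := by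
    intro x hx
    simp only [pages, Finset.mem_filter] at hx
    obtain ⟨hxS, hxq, hxE⟩ := hx
    have hE : {v, w, x} ∈ E := h.down _ hxE _ (by grind)
    refine ⟨?_, hE⟩
    intro hx
    have hxp : x ∈ p := by grind
    obtain ⟨b, hb, rfl⟩ := exists_eq_pair (Finset.mem_filter.1 hp).2.1 hxp
    have := h.eq_of_spine hwv.symm (x := x) (y := b) (by grind) (by grind) hE hsp (by grind) hb
      (h.down _ h2 _ (by grind))
    grind
  have hsub : pages E S {v, w} ⊆ outer E S (insert v p) := by
    intro x hx
    obtain ⟨hxD, hE⟩ := hpages x hx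
    have hxq := (Finset.mem_filter.1 hx).2.1
    exact Finset.mem_filter.2 ⟨(Finset.mem_filter.1 hx).1, hxD, _, hE, by simp,
      Finset.not_disjoint_iff.2 ⟨v, by simp, by simp⟩,
      two_le_card_sdiff (y := x) (z := w) (by simp) hxD (by simp) hwD (by grind)⟩
  have hdisj : Disjoint (pages E S p) (pages E S {v, w}) := by
    rw [Finset.disjoint_left]
    intro x hxp hx
    obtain ⟨hxD, hE⟩ := hpages x hx
    have hxq := (Finset.mem_filter.1 hx).2.1
    obtain ⟨a, ha⟩ := Finset.card_pos.1
      (show 0 < #p by have := (Finset.mem_filter.1 hp).2.1; omega)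
    refine h.not_adj_of_outer h2 h1 hE (v := v) (y := x) (z := w) (u := a) (by simp) (by simp)
      (by simp) hxD (by simp) hwD (by grind) (by simp [ha]) (by grind) ?_
    exact h.down _ (Finset.mem_filter.1 hxp).2.2 _ (by grind)
  have hcard : #(pages E S p) + #(pages E S {v, w}) ≤ #S := by
    rw [← Finset.card_union_of_disjoint hdisj]
    exact Finset.card_le_card
      (Finset.union_subset (Finset.filter_subset _ _) (Finset.filter_subset _ _))
  have := Finset.card_le_card hsub
  omega

/-- The triangles on `p` and `q` with a common page meet only there, so an edge between the spines
completes a bowtie. -/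
theorem not_adj_of_common_page (h : Irreducible E S) {p q : Finset V} (hp : p ∈ spines E S)
    (hq : q ∈ spines E S) (hpq : p ≠ q) (hnd : ¬ Disjoint (pages E S p) (pages E S q)) {a c : V}
    (ha : a ∈ p) (hc : c ∈ q) : {a, c} ∉ E := by
  obtain ⟨x, hxp, hxq⟩ := Finset.not_disjoint_iff.1 hnd
  have hdis := Finset.disjoint_left.1 (h.disjoint_spines hp hq hpq)
  obtain ⟨b, hb, rfl⟩ := exists_eq_pair (Finset.mem_filter.1 hp).2.1 ha
  obtain ⟨d, hd, rfl⟩ := exists_eq_pair (Finset.mem_filter.1 hq).2.1 hc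
  have hxp' := (Finset.mem_filter.1 hxp).2
  have hxq' := (Finset.mem_filter.1 hxq).2
  refine h.no_bowtie x a b c d ?_ hxp'.2 hxq'.2
  have h1 : x ≠ a := by grind
  have h2 : x ≠ b := by grind
  have h3 : x ≠ c := by grind
  have h4 : x ≠ d := by grind
  have h5 : a ∉ ({c, d} : Finset V) := hdis (by simp)
  have h6 : b ∉ ({c, d} : Finset V) := hdis (by simp)
  simp only [Finset.mem_insert, Finset.mem_singleton, not_or] at h5 h6
  simp [h1, h2, h3, h4, h5.1, h5.2, h6.1, h6.2, hb.symm, hd.symm]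

/-! ### Counting the edges of an irreducible complex -/

theorem card_biUnion_spines (h : Irreducible E S) :
    #((spines E S).biUnion id) = 2 * #(spines E S) := by
  rw [Finset.card_biUnion (t := id) fun p hp q hq hpq => h.disjoint_spines hp hq hpq,
    Finset.sum_congr rfl fun p hp => show #(id p) = 2 from (Finset.mem_filter.1 hp).2.1]
  simp [mul_comm]

theorem biUnion_spines_subset (h : Irreducible E S) : (spines E S).biUnion id ⊆ S :=
  Finset.biUnion_subset.2 fun p hp => h.subset p (Finset.mem_filter.1 hp).1

theorem pages_subset (h : Irreducible E S) {p : Finset V} (hp : p ∈ spines E S) :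
    pages E S p ⊆ S \ (spines E S).biUnion id := by
  intro x hx
  refine Finset.mem_sdiff.2 ⟨(Finset.mem_filter.1 hx).1, fun hxU => ?_⟩
  obtain ⟨q, hq, hxq⟩ := Finset.mem_biUnion.1 hxU
  exact Finset.disjoint_left.1 (h.disjoint_pages_spine hp hq) hx hxq

/-- The spines that have no page in common with some other spine. -/
def isolated (E : Finset (Finset V)) (S : Finset V) : Finset (Finset V) :=
  {p ∈ spines E S | ∃ q ∈ spines E S, Disjoint (pages E S p) (pages E S q)}

/-- A pair covered by the spines, but not itself a spine, joins two spines without a common page, so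
both are in `isolated`. -/
theorem card_pairs_le (h : Irreducible E S) :
    #{s ∈ E | #s = 2} ≤ (#(S \ (spines E S).biUnion id)).choose 2 +
      #(S \ (spines E S).biUnion id) * (2 * #(spines E S)) + #(spines E S) +
      (2 * #(isolated E S)).choose 2 := by
  set U := (spines E S).biUnion id with hU
  have hsub : {s ∈ E | #s = 2} ⊆ (S \ U).powersetCard 2 ∪
      ((S \ U) ×ˢ U).image (fun z => {z.1, z.2}) ∪ spines E S ∪
      ((isolated E S).biUnion id).powersetCard 2 := by
    intro s hs
    rw [Finset.mem_filter] at hs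
    obtain ⟨hsE, hs2⟩ := hs
    obtain ⟨x, y, hxy, rfl⟩ := Finset.card_eq_two.1 hs2
    have hxS : x ∈ S := h.subset _ hsE (by simp)
    have hyS : y ∈ S := h.subset _ hsE (by simp)
    simp only [Finset.mem_union, Finset.mem_image, Finset.mem_powersetCard, Finset.mem_product,
      Finset.mem_sdiff, Prod.exists]
    by_cases hxU : x ∈ U
    · by_cases hyU : y ∈ U
      · obtain ⟨p, hp, hxp⟩ := Finset.mem_biUnion.1 hxU
        obtain ⟨q, hq, hyq⟩ := Finset.mem_biUnion.1 hyU
        by_cases hpq : p = q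
        · subst hpq
          left; right
          have : {x, y} = p := Finset.eq_of_subset_of_card_le
            (Finset.insert_subset hxp (Finset.singleton_subset_iff.2 hyq))
            (by rw [hs2, (Finset.mem_filter.1 hp).2.1])
          rwa [this]
        · right
          have hd : Disjoint (pages E S p) (pages E S q) := by
            by_contra hnd
            exact h.not_adj_of_common_page hp hq hpq hnd hxp hyq hsE
          have hxi : x ∈ (isolated E S).biUnion id :=
            Finset.mem_biUnion.2 ⟨p, Finset.mem_filter.2 ⟨hp, q, hq, hd⟩, hxp⟩
          have hyi : y ∈ (isolated E S).biUnion id :=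
            Finset.mem_biUnion.2 ⟨q, Finset.mem_filter.2 ⟨hq, p, hp, hd.symm⟩, hyq⟩
          exact ⟨Finset.insert_subset hxi (Finset.singleton_subset_iff.2 hyi), hs2⟩
      · left; left; right
        exact ⟨y, x, ⟨⟨hyS, hyU⟩, hxU⟩, Finset.pair_comm _ _⟩
    · by_cases hyU : y ∈ U
      · left; left; right
        exact ⟨x, y, ⟨⟨hxS, hxU⟩, hyU⟩, rfl⟩
      · left; left; left
        exact ⟨Finset.insert_subset (Finset.mem_sdiff.2 ⟨hxS, hxU⟩)
          (Finset.singleton_subset_iff.2 (Finset.mem_sdiff.2 ⟨hyS, hyU⟩)), hs2⟩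
  have h1 : #((isolated E S).biUnion id) ≤ 2 * #(isolated E S) := by
    rw [mul_comm]
    refine Finset.card_biUnion_le_card_mul _ _ _ fun p hp => ?_
    exact (Finset.mem_filter.1 (Finset.mem_filter.1 hp).1).2.1.le
  calc _ ≤ _ := Finset.card_le_card hsub
    _ ≤ #((S \ U).powersetCard 2) + #(((S \ U) ×ˢ U).image (fun z => ({z.1, z.2} : Finset V))) +
        #(spines E S) + #(((isolated E S).biUnion id).powersetCard 2) := by
      refine (Finset.card_union_le _ _).trans (Nat.add_le_add_right ?_ _)
      refine (Finset.card_union_le _ _).trans (Nat.add_le_add_right ?_ _)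
      exact Finset.card_union_le _ _
    _ ≤ _ := by
      rw [Finset.card_powersetCard, Finset.card_powersetCard, ← h.card_biUnion_spines,
        ← Finset.card_product]
      gcongr
      exact Finset.card_image_le

theorem card_triples_le (h : Irreducible E S) :
    #{s ∈ E | #s = 3} ≤ ∑ p ∈ spines E S, #(pages E S p) := by
  have hsub : {s ∈ E | #s = 3} ⊆
      (spines E S).biUnion fun p => (pages E S p).image fun y => insert y p := by
    intro s hs
    rw [Finset.mem_filter] at hs
    obtain ⟨p, hps, hp⟩ := h.exists_spine hs.1 hs.2
    have hp2 := (Finset.mem_filter.1 hp).2.1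
    obtain ⟨y, hy, hyp⟩ := Finset.exists_mem_notMem_of_card_lt_card (show #p < #s by omega)
    refine Finset.mem_biUnion.2 ⟨p, hp, Finset.mem_image.2
      ⟨y, h.mem_pages_of_subset hs.1 hps hy hyp, ?_⟩⟩
    refine Finset.eq_of_subset_of_card_le (Finset.insert_subset hy hps) ?_
    rw [Finset.card_insert_of_notMem hyp]
    omega
  refine (Finset.card_le_card hsub).trans (Finset.card_biUnion_le.trans ?_)
  exact Finset.sum_le_sum fun p _ => Finset.card_image_le

theorem card_edges_le_sum (h : Irreducible E S) :
    #E ≤ 1 + #S + #{s ∈ E | #s = 2} + #{s ∈ E | #s = 3} := by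
  have hsub : E ⊆ {∅} ∪ S.powersetCard 1 ∪ {s ∈ E | #s = 2} ∪ {s ∈ E | #s = 3} := by
    intro s hs
    have h3 := h.card_le_three hs
    simp only [Finset.mem_union, Finset.mem_singleton, Finset.mem_powersetCard, h.subset s hs,
      Finset.mem_filter, hs, true_and, ← Finset.card_eq_zero (s := s)]
    omega
  refine (Finset.card_le_card hsub).trans ?_
  refine (Finset.card_union_le _ _).trans (Nat.add_le_add_right ?_ _)
  refine (Finset.card_union_le _ _).trans (Nat.add_le_add_right ?_ _)
  refine (Finset.card_union_le _ _).trans ?_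
  simp

theorem card_pages_add_le (h : Irreducible E S) {p q : Finset V} (hp : p ∈ spines E S)
    (hq : q ∈ spines E S) (hd : Disjoint (pages E S p) (pages E S q)) :
    #(pages E S p) + #(pages E S q) ≤ #(S \ (spines E S).biUnion id) := by
  rw [← Finset.card_union_of_disjoint hd]
  exact Finset.card_le_card (Finset.union_subset (h.pages_subset hp) (h.pages_subset hq))

/-- The pages of an isolated spine miss those of some other spine, of which there are at least (6n +
4)/16. -/
theorem sum_card_pages_le (h : Irreducible E S) :
    16 * ∑ p ∈ spines E S, #(pages E S p) + #(isolated E S) * (6 * #S + 4) ≤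
      16 * (#(spines E S) * #(S \ (spines E S).biUnion id)) := by
  have h1 : #(isolated E S) * (6 * #S + 4) =
      ∑ p ∈ spines E S, if ∃ q ∈ spines E S, Disjoint (pages E S p) (pages E S q)
        then 6 * #S + 4 else 0 := by
    rw [← Finset.sum_filter, Finset.sum_const, smul_eq_mul]
    rfl
  have h2 : 16 * (#(spines E S) * #(S \ (spines E S).biUnion id)) =
      ∑ p ∈ spines E S, 16 * #(S \ (spines E S).biUnion id) := by
    rw [Finset.sum_const, smul_eq_mul]
    ring
  rw [h1, h2, Finset.mul_sum, ← Finset.sum_add_distrib]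
  refine Finset.sum_le_sum fun p hp => ?_
  split_ifs with hq
  · obtain ⟨q, hq, hd⟩ := hq
    have := h.card_pages_add_le hp hq hd
    have := h.lt_card_pages_of_mem_spines hq
    omega
  · have := Finset.card_le_card (h.pages_subset hp)
    omega

theorem card_edges_le (h : Irreducible E S) : 16 * #E ≤ 9 * #S ^ 2 + 12 * #S + 20 := by
  have h1 := h.card_edges_le_sum
  have h2 := h.card_pairs_le
  have h3 := h.card_triples_le
  have h4 := h.sum_card_pages_le
  have h5 : #(S \ (spines E S).biUnion id) + 2 * #(spines E S) = #S := by
    rw [← h.card_biUnion_spines, Finset.card_sdiff_add_card_eq_card h.biUnion_spines_subset]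
  have h6 : #(isolated E S) ≤ #(spines E S) := Finset.card_filter_le _ _
  have h7 : #(isolated E S) = 0 ∨ 12 * #S + 8 ≤ 16 * #(S \ (spines E S).biUnion id) := by
    rcases (isolated E S).eq_empty_or_nonempty with he | ⟨p, hp⟩
    · simp [he]
    · right
      obtain ⟨hp, q, hq, hd⟩ := Finset.mem_filter.1 hp
      have := h.card_pages_add_le hp hq hd
      have := h.lt_card_pages_of_mem_spines hp
      have := h.lt_card_pages_of_mem_spines hq
      omega
  generalize #(S \ (spines E S).biUnion id) = a at *
  generalize #(spines E S) = m at *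
  generalize #(isolated E S) = b at *
  generalize ∑ p ∈ spines E S, #(pages E S p) = P at *
  generalize #{s ∈ E | #s = 2} = e₂ at *
  generalize #{s ∈ E | #s = 3} = e₃ at *
  generalize #S = n at *
  generalize #E = e at *
  -- The extra pairs between isolated spines cost no more than the missing triangles: if `b` is
  -- positive then a is at least (12n + 8)/16, so 32b ≤ 32m ≤ 4n − 8.
  have h8 : 16 * (2 * b).choose 2 ≤ b * (6 * n + 4) := by
    rcases h7 with rfl | h7
    · simp
    · have hc : 2 * (2 * b).choose 2 ≤ 4 * b * b := by
        rw [Nat.choose_two_right, Nat.mul_div_cancel' (Nat.even_mul_pred_self _).two_dvd]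
        calc 2 * b * (2 * b - 1) ≤ 2 * b * (2 * b) := Nat.mul_le_mul_left _ (by omega)
          _ = 4 * b * b := by ring
      have hb : b * (32 * b) ≤ b * (6 * n + 4) := Nat.mul_le_mul_left _ (by omega)
      linarith
  subst h5
  have h9 : ((e : ℕ) : ℚ) ≤ 1 + (a + 2 * m) + a.choose 2 + a * (2 * m) + m + m * a := by
    have : e ≤ 1 + (a + 2 * m) + a.choose 2 + a * (2 * m) + m + m * a := by linarith
    exact_mod_cast this
  rw [Nat.cast_choose_two] at h9
  have h10 : (16 : ℚ) * e ≤ 9 * (a + 2 * m) ^ 2 + 12 * (a + 2 * m) + 20 := by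
    -- The difference of the two sides is exactly this square, once `h9` is inserted.
    nlinarith [sq_nonneg ((a : ℚ) + 2 - 6 * m)]
  exact_mod_cast h10

end BowtieFreeOn.Irreducible

/-! ### Induction for the upper bound -/

theorem BowtieFreeOn.card_edges_le (h : BowtieFreeOn E S) :
    16 * #E ≤ 9 * #S ^ 2 + 12 * #S + 16 * 2 ^ 13 := by
  induction hn : #S using Nat.strong_induction_on generalizing E S with
  | _ n ih =>
  subst hn
  have hpow : #E ≤ 2 ^ #S := by
    rw [← Finset.card_powerset]
    exact Finset.card_le_card fun s hs => Finset.mem_powerset.2 (h.subset s hs)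
  by_cases hlarge : 13 ≤ #S
  swap
  · have := hpow.trans (Nat.pow_le_pow_right (n := 2) (by norm_num) (show #S ≤ 13 by omega))
    nlinarith
  by_cases hmeet : ∀ D ∈ E, #D = 3 → 54 * #S < 16 * #{s ∈ E | ¬ Disjoint s D} + 45
  · have := Irreducible.card_edges_le ⟨h, hlarge, hmeet⟩
    omega
  push Not at hmeet
  obtain ⟨D, hDE, hD, hle⟩ := hmeet
  have h' : BowtieFreeOn {s ∈ E | Disjoint s D} (S \ D) := by
    refine ⟨?_, ?_, ?_⟩
    · intro s hs
      rw [Finset.mem_filter] at hs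
      exact Finset.subset_sdiff.2 ⟨h.subset s hs.1, hs.2⟩
    · intro s hs t hts
      rw [Finset.mem_filter] at hs ⊢
      exact ⟨h.down s hs.1 t hts, Finset.disjoint_of_subset_left hts hs.2⟩
    · intro a b c d e hnd h1 h2 h3
      rw [Finset.mem_filter] at h1 h2 h3
      exact h.no_bowtie a b c d e hnd h1.1 h2.1 h3.1
  have hcard : #(S \ D) + 3 = #S := by
    rw [← hD, Finset.card_sdiff_add_card_eq_card (h.subset D hDE)]
  have key := ih #(S \ D) (by omega) h' rfl
  have hsum := Finset.card_filter_add_card_filter_not (s := E) (fun s => Disjoint s D)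
  rw [← hcard] at hle ⊢
  nlinarith

theorem bowtieFreeOn_of_not_contains {V : Type*} [Fintype V] [DecidableEq V] {H : FinComplex V}
    (h : ¬ H.Contains bowtie) : BowtieFreeOn H.edges Finset.univ := by
  refine ⟨fun _ _ => Finset.subset_univ _, H.down_closed, ?_⟩
  intro a b c d e hnd h1 h2 h3
  -- The order puts `b` and `d` at positions 2 and 3, the ends of the connecting edge.
  refine h ⟨⟨![a, c, b, d, e], ?_⟩, ?_⟩
  · simp only [List.nodup_cons, List.mem_cons, List.not_mem_nil, or_false, not_or] at hnd
    intro i j hij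
    fin_cases i <;> fin_cases j <;> simp_all
  · intro s hs
    simp only [bowtie, generate, Finset.mem_biUnion, Finset.mem_powerset, Finset.mem_insert,
      Finset.mem_singleton] at hs
    obtain ⟨g, hg, hsg⟩ := hs
    refine H.down_closed _ ?_ _ (Finset.map_subset_map.2 hsg)
    rcases hg with rfl | rfl | rfl
    · simp only [Finset.map_insert, Finset.map_singleton]
      exact h3
    · rw [Finset.pair_comm b c] at h1
      simp only [Finset.map_insert, Finset.map_singleton]
      exact h1
    · simp only [Finset.map_insert, Finset.map_singleton]
      exact h2

theorem bowtie_edges_nonempty : bowtie.edges.Nonempty :=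
  ⟨∅, by simp [bowtie, generate]⟩

theorem ex_bowtie_le (n : ℕ) : 16 * ex n bowtie ≤ 9 * n ^ 2 + 12 * n + 16 * 2 ^ 13 := by
  obtain ⟨H, hH, hcard⟩ := (ex_isGreatest n bowtie bowtie_edges_nonempty).1
  simpa [hcard] using (bowtieFreeOn_of_not_contains hH).card_edges_le

/-! ### The lower bound construction -/

/-- The complex on `n` vertices whose triangles are the sets `{2j, 2j + 1, x}` with `j < m` and
`x ≥ 2m`, and whose pairs are all those that do not meet two different blocks `{2j, 2j + 1}`. -/
def bookComplex (n m : ℕ) : FinComplex (Fin n) where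
  edges := {s | (#s ≤ 2 ∨ #s = 3 ∧ #{x ∈ s | x.val < 2 * m} = 2) ∧
    ∀ x ∈ s, ∀ y ∈ s, x.val < 2 * m → y.val < 2 * m → x.val / 2 = y.val / 2}
  down_closed := by
    intro s hs t hts
    simp only [Finset.mem_filter, Finset.mem_univ, true_and] at hs ⊢
    refine ⟨?_, fun x hx y hy => hs.2 x (hts hx) y (hts hy)⟩
    have hc := Finset.card_le_card hts
    by_cases h2 : #t ≤ 2
    · exact Or.inl h2
    · rw [Finset.eq_of_subset_of_card_le hts (by omega)]
      exact hs.1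

theorem mem_bookComplex {n m : ℕ} {s : Finset (Fin n)} : s ∈ (bookComplex n m).edges ↔
    (#s ≤ 2 ∨ #s = 3 ∧ #{x ∈ s | x.val < 2 * m} = 2) ∧
    ∀ x ∈ s, ∀ y ∈ s, x.val < 2 * m → y.val < 2 * m → x.val / 2 = y.val / 2 := by
  simp [bookComplex]

theorem triple_mem_bookComplex {n m : ℕ} {a b c : Fin n} (hab : a ≠ b) (hac : a ≠ c) (hbc : b ≠ c)
    (h : {a, b, c} ∈ (bookComplex n m).edges) :
    (a.val < 2 * m ∧ b.val < 2 * m ∧ 2 * m ≤ c.val ∧ a.val / 2 = b.val / 2) ∨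
    (a.val < 2 * m ∧ c.val < 2 * m ∧ 2 * m ≤ b.val ∧ a.val / 2 = c.val / 2) ∨
    (b.val < 2 * m ∧ c.val < 2 * m ∧ 2 * m ≤ a.val ∧ b.val / 2 = c.val / 2) := by
  obtain ⟨h1, h2⟩ := mem_bookComplex.1 h
  have h3 : #{a, b, c} = 3 := Finset.card_eq_three.2 ⟨a, b, c, hab, hac, hbc, rfl⟩
  have h4 : #{x ∈ ({a, b, c} : Finset (Fin n)) | x.val < 2 * m} = 2 := by omega
  have hab' := h2 a (by simp) b (by simp)
  have hac' := h2 a (by simp) c (by simp)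
  have hbc' := h2 b (by simp) c (by simp)
  by_cases ha : a.val < 2 * m <;> by_cases hb : b.val < 2 * m <;> by_cases hc : c.val < 2 * m <;>
    simp [Finset.filter_insert, Finset.filter_singleton, ha, hb, hc, hab, hac, hbc] at h4 <;> omega

/-- Suppose two triangles meet in one vertex. It cannot lie in a block, since both would contain
that whole block. So it is a page, and the connecting edge would join two different blocks. -/
theorem bookComplex_not_contains (n m : ℕ) : ¬ (bookComplex n m).Contains bowtie := by
  rintro ⟨f, hf⟩
  have hmem : ∀ g ∈ ({{2, 3}, {0, 1, 2}, {0, 3, 4}} : Finset (Finset (Fin 5))),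
      g.map f ∈ (bookComplex n m).edges := fun g hg =>
    hf g (Finset.mem_biUnion.2 ⟨g, hg, Finset.mem_powerset_self g⟩)
  have h1 := hmem {2, 3} (by simp)
  have h2 := hmem {0, 1, 2} (by simp)
  have h3 := hmem {0, 3, 4} (by simp)
  simp only [Finset.map_insert, Finset.map_singleton] at h1 h2 h3
  have hne : ∀ i j : Fin 5, i ≠ j → f i ≠ f j := fun i j hij => f.injective.ne hij
  have hne' : ∀ i j : Fin 5, i ≠ j → (f i).val ≠ (f j).val :=
    fun i j hij => Fin.val_ne_of_ne (hne i j hij)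
  have h2' := triple_mem_bookComplex (hne 0 1 (by decide)) (hne 0 2 (by decide))
    (hne 1 2 (by decide)) h2
  have h3' := triple_mem_bookComplex (hne 0 3 (by decide)) (hne 0 4 (by decide))
    (hne 3 4 (by decide)) h3
  have h1' := (mem_bookComplex.1 h1).2 (f 2) (by simp) (f 3) (by simp)
  have := hne' 0 1 (by decide)
  have := hne' 0 2 (by decide)
  have := hne' 0 3 (by decide)
  have := hne' 0 4 (by decide)
  have := hne' 1 2 (by decide)
  have := hne' 1 3 (by decide)
  have := hne' 1 4 (by decide)
  have := hne' 2 3 (by decide)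
  have := hne' 2 4 (by decide)
  omega

theorem sum_card_crossing_le {V : Type*} [DecidableEq V] (E : Finset (Finset V)) (D : Finset V)
    (K : Finset (ℕ × ℕ)) : ∑ k ∈ K, #(crossing E D k.1 k.2) ≤ #E := by
  have h := Finset.sum_card_fiberwise_eq_card_filter E K (fun s => (#(s ∩ D), #(s \ D)))
  simp only [Prod.ext_iff] at h
  exact h.trans_le (Finset.card_filter_le _ _)

/-- Edges are sorted by how many vertices they have inside and outside the union `B` of the blocks;
seven types suffice for the lower bound. -/
theorem card_bookComplex {n m : ℕ} (hm : 2 * m ≤ n) :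
    1 + n + (n - 2 * m).choose 2 + (n - 2 * m) * (2 * m) + m + (n - 2 * m) * m ≤
      #(bookComplex n m).edges := by
  set B : Finset (Fin n) := {x | x.val < 2 * m} with hB
  have hmemB : ∀ x, x ∈ B ↔ x.val < 2 * m := by simp [hB]
  have hBcard : #B = 2 * m := by
    rw [hB, Fin.card_filter_val_lt]
    exact min_eq_right hm
  have hAcard : #Bᶜ = n - 2 * m := by
    rw [Finset.card_compl, hBcard, Fintype.card_fin]
  let block (j : Fin m) : Finset (Fin n) :=
    {⟨2 * j.val, by omega⟩, ⟨2 * j.val + 1, by omega⟩}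
  have hblock : ∀ j x, x ∈ block j ↔ x.val / 2 = j.val := by
    intro j x
    simp only [block, Finset.mem_insert, Finset.mem_singleton, Fin.ext_iff]
    omega
  have hblockB : ∀ j, block j ⊆ B := by
    intro j x hx
    rw [hblock] at hx
    rw [hmemB]
    omega
  have hblock2 : ∀ j, #(block j) = 2 := fun j => Finset.card_pair (by simp [Fin.ext_iff])
  have hblockinj : ∀ i j, block i = block j → i = j := by
    intro i j hij
    have h1 : (⟨2 * i.val, by omega⟩ : Fin n) ∈ block j := by
      rw [← hij, hblock]; simp
    rw [hblock] at h1
    ext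
    simpa using h1
  set E := (bookComplex n m).edges with hE
  have h00 : 1 ≤ #(crossing E B 0 0) := by
    refine Finset.card_pos.2 ⟨∅, ?_⟩
    simp [crossing, hE, mem_bookComplex]
  have h01 : #Bᶜ ≤ #(crossing E B 0 1) := by
    refine Finset.card_le_card_of_injOn (fun x => {x}) ?_ (by simp)
    intro x hx
    have hx : x ∉ B := by simpa using hx
    have hd : ({x} : Finset (Fin n)) \ B = {x} :=
      Finset.sdiff_eq_self_of_disjoint (Finset.disjoint_singleton_left.2 hx)
    simp [crossing, hE, mem_bookComplex, hx, hd]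
  have h10 : #B ≤ #(crossing E B 1 0) := by
    refine Finset.card_le_card_of_injOn (fun x => {x}) ?_ (by simp)
    intro x hx
    have hx : x ∈ B := by simpa using hx
    simp [crossing, hE, mem_bookComplex, hx]
  have h02 : (#Bᶜ).choose 2 ≤ #(crossing E B 0 2) := by
    rw [← Finset.card_powersetCard]
    refine Finset.card_le_card fun s hs => ?_
    rw [Finset.mem_powersetCard] at hs
    have hd : Disjoint s B := Finset.disjoint_left.2 fun x hx => by simpa using hs.1 hx
    refine Finset.mem_filter.2 ⟨mem_bookComplex.2 ⟨Or.inl hs.2.le, ?_⟩, ?_, ?_⟩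
    · intro x hx y hy hxm
      exact absurd ((hmemB x).2 hxm) (Finset.disjoint_left.1 hd hx)
    · rw [Finset.disjoint_iff_inter_eq_empty.1 hd, Finset.card_empty]
    · rw [Finset.sdiff_eq_self_of_disjoint hd, hs.2]
  have h11 : #Bᶜ * #B ≤ #(crossing E B 1 1) := by
    rw [← Finset.card_product]
    refine Finset.card_le_card_of_injOn (fun z => {z.1, z.2}) ?_ ?_
    · rintro ⟨x, y⟩ hz
      simp only [Finset.coe_product, Set.mem_prod, Finset.mem_coe, Finset.mem_compl] at hz
      refine Finset.mem_filter.2 ⟨mem_bookComplex.2 ⟨Or.inl Finset.card_le_two, ?_⟩, ?_, ?_⟩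
      · intro u hu v hv
        rw [← hmemB, ← hmemB]
        grind
      · exact Finset.card_eq_one.2 ⟨y, by grind⟩
      · exact Finset.card_eq_one.2 ⟨x, by grind⟩
    · rintro ⟨x, y⟩ hz ⟨x', y'⟩ hz' heq
      simp only [Finset.coe_product, Set.mem_prod, Finset.mem_coe, Finset.mem_compl] at hz hz' heq
      have h1 := Finset.ext_iff.1 heq x
      have h2 := Finset.ext_iff.1 heq y
      grind
  have h20 : m ≤ #(crossing E B 2 0) := by
    have : m = #(Finset.univ : Finset (Fin m)) := by simp
    refine this.le.trans (Finset.card_le_card_of_injOn block ?_ fun i _ j _ hij => hblockinj i j hij)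
    intro j _
    refine Finset.mem_filter.2 ⟨mem_bookComplex.2 ⟨Or.inl (hblock2 j).le, ?_⟩, ?_, ?_⟩
    · intro u hu v hv _ _
      rw [hblock] at hu hv
      rw [hu, hv]
    · rw [Finset.inter_eq_left.2 (hblockB j), hblock2]
    · rw [Finset.sdiff_eq_empty_iff_subset.2 (hblockB j), Finset.card_empty]
  have h21 : #Bᶜ * m ≤ #(crossing E B 2 1) := by
    have : #Bᶜ * m = #(Bᶜ ×ˢ (Finset.univ : Finset (Fin m))) := by simp [Finset.card_product]
    have hint : ∀ x ∉ B, ∀ j, insert x (block j) ∩ B = block j := by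
      intro x hx j
      rw [Finset.insert_inter_of_notMem hx, Finset.inter_eq_left.2 (hblockB j)]
    have hdiff : ∀ x ∉ B, ∀ j, insert x (block j) \ B = {x} := by
      intro x hx j
      rw [Finset.insert_sdiff_of_notMem _ hx, Finset.sdiff_eq_empty_iff_subset.2 (hblockB j)]
      rfl
    refine this.le.trans (Finset.card_le_card_of_injOn (fun z => insert z.1 (block z.2)) ?_ ?_)
    · rintro ⟨x, j⟩ hz
      have hx : x ∉ B := by simpa using hz
      refine Finset.mem_filter.2 ⟨mem_bookComplex.2 ⟨Or.inr ⟨?_, ?_⟩, ?_⟩, ?_, ?_⟩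
      · rw [Finset.card_insert_of_notMem fun hh => hx (hblockB j hh), hblock2]
      · have : {y ∈ insert x (block j) | y.val < 2 * m} = insert x (block j) ∩ B := by
          ext y
          simp [hmemB]
        rw [this, hint x hx, hblock2]
      · intro u hu v hv hum hvm
        rw [← hmemB] at hum hvm
        have hu' : u ∈ block j := by
          rw [← hint x hx j]; exact Finset.mem_inter.2 ⟨hu, hum⟩
        have hv' : v ∈ block j := by
          rw [← hint x hx j]; exact Finset.mem_inter.2 ⟨hv, hvm⟩
        rw [hblock] at hu' hv'
        rw [hu', hv']
      · simp only [hint x hx j, hblock2]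
      · simp only [hdiff x hx j, Finset.card_singleton]
    · rintro ⟨x, i⟩ hz ⟨y, j⟩ hz' heq
      have hx : x ∉ B := by simpa using hz
      have hy : y ∉ B := by simpa using hz'
      simp only at heq
      have h1 : block i = block j := by rw [← hint x hx i, ← hint y hy j, heq]
      have h2 : ({x} : Finset (Fin n)) = {y} := by rw [← hdiff x hx i, ← hdiff y hy j, heq]
      rw [Finset.singleton_inj.1 h2, hblockinj i j h1]
  have hsum := sum_card_crossing_le E B {(0, 0), (0, 1), (1, 0), (0, 2), (1, 1), (2, 0), (2, 1)}
  simp at hsum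
  rw [hAcard] at h01 h02 h11 h21
  rw [hBcard] at h10 h11
  omega

theorem le_ex_bowtie {n m : ℕ} (hm : 2 * m ≤ n) :
    1 + n + (n - 2 * m).choose 2 + (n - 2 * m) * (2 * m) + m + (n - 2 * m) * m ≤ ex n bowtie :=
  (card_bookComplex hm).trans ((ex_isGreatest n bowtie bowtie_edges_nonempty).2
    ⟨bookComplex n m, bookComplex_not_contains n m, rfl⟩)

/-- Here r = a + 2 − 6m with a = n − 2m, so r²/16 is the loss from the square in the upper bound. -/
theorem ex_bowtie_ge_of_eq {n m r : ℕ} (hn : n + 2 = 8 * m + r) (hm : 2 * m ≤ n) :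
    9 / 8 * (n.choose 2 : ℝ) + 21 / 16 * (n : ℝ) + 5 / 4 - (r : ℝ) ^ 2 / 16 ≤ ex n bowtie := by
  have h : ((1 + n + (n - 2 * m).choose 2 + (n - 2 * m) * (2 * m) + m + (n - 2 * m) * m : ℕ) : ℝ) ≤
      ex n bowtie := by exact_mod_cast le_ex_bowtie hm
  push_cast [Nat.cast_choose_two, Nat.cast_sub hm] at h
  rw [Nat.cast_choose_two]
  have hn' : (n : ℝ) = 8 * m + r - 2 := by
    have : ((n + 2 : ℕ) : ℝ) = ((8 * m + r : ℕ) : ℝ) := by rw [hn]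
    push_cast at this
    linarith
  rw [hn'] at h ⊢
  refine le_trans (le_of_eq ?_) h
  ring

end FinComplex

theorem theorem1p2 :
    (∃ C : ℕ, ∀ n : ℕ, 5 ≤ n →
      (FinComplex.ex n FinComplex.bowtie : ℝ) ≤
        9 / 8 * (n.choose 2 : ℝ) + 21 / 16 * (n : ℝ) + (C : ℝ)) ∧
    (∃ C : ℕ, ∀ n : ℕ, 5 ≤ n →
      9 / 8 * (n.choose 2 : ℝ) + 21 / 16 * (n : ℝ) - (C : ℝ) ≤
        (FinComplex.ex n FinComplex.bowtie : ℝ)) ∧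
    (∀ n : ℕ, n % 8 = 6 →
      9 / 8 * (n.choose 2 : ℝ) + 21 / 16 * (n : ℝ) + 5 / 4 ≤
        (FinComplex.ex n FinComplex.bowtie : ℝ)) := by
  -- The constant 2 suffices because r ≤ 7 and 49/16 − 5/4 < 2.
  refine ⟨⟨2 ^ 13, fun n _ => ?_⟩, ⟨2, fun n hn => ?_⟩, fun n hn => ?_⟩
  · have h : ((16 * FinComplex.ex n FinComplex.bowtie : ℕ) : ℝ) ≤
        ((9 * n ^ 2 + 12 * n + 16 * 2 ^ 13 : ℕ) : ℝ) := by
      exact_mod_cast FinComplex.ex_bowtie_le n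
    push_cast at h
    rw [Nat.cast_choose_two]
    push_cast
    linarith
  · have h := FinComplex.ex_bowtie_ge_of_eq (n := n) (m := (n + 2) / 8) (r := (n + 2) % 8)
      (by omega) (by omega)
    have hr : (((n + 2) % 8 : ℕ) : ℝ) ≤ 7 := by
      exact_mod_cast (show (n + 2) % 8 ≤ 7 by omega)
    have hr0 : (0 : ℝ) ≤ (((n + 2) % 8 : ℕ) : ℝ) := by positivity
    push_cast at h ⊢
    nlinarith
  · have h := FinComplex.ex_bowtie_ge_of_eq (n := n) (m := (n + 2) / 8) (r := 0)
      (by omega) (by omega)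
    simpa using h
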